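/- Let $M$ be a matroid of rank $r$ on a set $S$ of $n$ elements (loops are allowed), with Tutte polynomial $$T(M;x,y)=\sum_{A\subseteq S}(x-1)^{r-\mathrm{rk}(A)}(y-1)^{|A|-\mathrm{rk}(A)} .$$ For integers $0\le k\le r$, $k\le m$ and $t$ with $t=0$ or $1\le t\le r-k-1$, the flat number $f^t_{k,m}$ of $M$ is defined as follows: $f^0_{k,m}$ is the number of flats of $M$ of rank $k$ and size $m$, and for $1\le t\le r-k-1$, $$f^t_{k,m}=-\sum_{X}\mu\bigl(\mathrm{Trun}_{t+1}(M/X)\bigr),$$ where $X$ ranges over the flats of rank $k$ and size $m$, $\mathrm{Trun}_{t+1}(M/X)$ is the contraction $M/X$ truncated to rank $t+1$, and $\mu(N)=\mu_{L(N)}(\hat 0,\hat 1)$ is the (signed) Möbius function of the lattice of flats of the loopless matroid $N$, evaluated from its minimum to its maximum. For $i,j\in\mathbb Z$ the total flat number is $$F_{ij}(M)=\sum_{\substack{k,m,t\\ r-k-t=i,\ m-k-t=j}} f^t_{k,m},$$ and the $F$-tableau of $M$ is the array $(F_{ij}(M))_{i,j}$. Among matroids of rank $r$ on $n$ elements, the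 Tutte polynomial determines, and is determined by, the $F$-tableau: for any two such matroids $M,N$, one has $T(M)=T(N)$ if and only if $F_{ij}(M)=F_{ij}(N)$ for all $i,j$. Moreover, the entries with $i,j\ge 1$ already suffice: if $F_{ij}(M)=F_{ij}(N)$ for all $i,j\ge1$, then $T(M)=T(N)$. -/

import Mathlib

open Set

/-- The rank of a set `A` in a matroid, as a natural number (used for finite matroids only). -/
noncomputable def Matroid.natRk {α : Type*} (M : Matroid α) (A : Set α) : ℕ := (M.eRk A).toNat

/-- The rank of a matroid, as a natural number (used for finite matroids only). -/
noncomputable def Matroid.natRank {α : Type*} (M : Matroid α) : ℕ := M.eRank.toNat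

/-- The finset of all subsets of the (finite) ground set. -/
noncomputable def Matroid.groundSubsets {α : Type*} (M : Matroid α) [M.Finite] :
    Finset (Finset α) :=
  M.ground_finite.toFinset.powerset

/-- The Tutte polynomial
`T(M; x, y) = ∑_{A ⊆ S} (x - 1) ^ (r - rk A) * (y - 1) ^ (|A| - rk A)`,
with `x = X 0` and `y = X 1`. -/
noncomputable def Matroid.tuttePoly {α : Type*} (M : Matroid α) [M.Finite] :
    MvPolynomial (Fin 2) ℤ :=
  ∑ A ∈ M.groundSubsets,
    (MvPolynomial.X 0 - 1) ^ (M.natRank - M.natRk (A : Set α)) *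
      (MvPolynomial.X 1 - 1) ^ (A.card - M.natRk (A : Set α))

/-- The truncation of `M` to rank `k` (iterated truncation until the rank is `k`, if
`k ≤ rk M`): the independent sets are the independent sets of `M` with at most `k` elements. -/
def Matroid.truncateTo {α : Type*} (M : Matroid α) (k : ℕ) : Matroid α :=
  (IndepMatroid.ofBddAugment M.E (fun I => M.Indep I ∧ I.encard ≤ k)
    ⟨M.empty_indep, by simp⟩
    (fun _ _ hJ hIJ => ⟨hJ.1.subset hIJ, (encard_le_encard hIJ).trans hJ.2⟩)
    (fun I J hI hJ hlt => by
      obtain ⟨e, he, hi⟩ := hI.1.augment hJ.1 hlt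
      exact ⟨e, he.1, he.2, hi,
        (encard_insert_le I e).trans ((Order.add_one_le_of_lt hlt).trans hJ.2)⟩)
    ⟨k, fun _ hI => hI.2⟩
    (fun _ hI => hI.1.subset_ground)).matroid

instance Matroid.truncateTo_finite {α : Type*} (M : Matroid α) [M.Finite] (k : ℕ) :
    (M.truncateTo k).Finite :=
  ⟨M.ground_finite⟩

/-- The lattice of flats of a matroid, ordered by inclusion. -/
abbrev Matroid.FlatLattice {α : Type*} (M : Matroid α) : Type _ := {X : Set α // M.IsFlat X}

instance Matroid.finite_flatLattice {α : Type*} (M : Matroid α) [M.Finite] :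
    Finite M.FlatLattice :=
  Set.Finite.to_subtype (s := {X : Set α | M.IsFlat X})
    (M.ground_finite.finite_subsets.subset fun _ hX => hX.subset_ground)

noncomputable instance Matroid.locallyFiniteOrder_flatLattice {α : Type*} (M : Matroid α)
    [M.Finite] : LocallyFiniteOrder M.FlatLattice :=
  LocallyFiniteOrder.ofFiniteIcc fun _ _ => Set.toFinite _

open Classical in
/-- The signed Möbius invariant of a finite matroid: the Möbius function of the lattice of flats,
evaluated from the minimum `cl ∅ = ∅` to the maximum `S`, if there are no loops; `0` if there is
a loop. -/
noncomputable def Matroid.moebius {α : Type*} (M : Matroid α) [M.Finite] : ℤ :=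
  if M.Loopless then
    IncidenceAlgebra.mu ℤ (⟨M.closure ∅, M.isFlat_closure ∅⟩ : M.FlatLattice)
      ⟨M.E, M.ground_isFlat⟩
  else 0

open Classical in
/-- The flats of `M` with rank `k` and size `m`. -/
noncomputable def Matroid.flatsOf {α : Type*} (M : Matroid α) [M.Finite] (k m : ℕ) :
    Finset (Finset α) :=
  M.groundSubsets.filter fun X => M.IsFlat (X : Set α) ∧ M.natRk (X : Set α) = k ∧ X.card = m

/-- The flat number `f^t_{k,m}`: the number of flats of rank `k` and size `m` if `t = 0`, and
`- ∑_X μ(Trun(M / X))` if `t ≥ 1`, where `X` ranges over these flats and `M / X` is truncated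
to rank `t + 1`; meant for `t < r - k` or `t = 0`. -/
noncomputable def Matroid.flatNumber {α : Type*} (M : Matroid α) [M.Finite] (k m t : ℕ) : ℤ :=
  if t = 0 then ((M.flatsOf k m).card : ℤ)
  else - ∑ X ∈ M.flatsOf k m, ((M.contract (X : Set α)).truncateTo (t + 1)).moebius

/-- The total flat number `F_{ij}`: the sum of `f^t_{k,m}` over all admissible indices with
`r - k - t = i` and `m - k - t = j`.  Admissible means `k ≤ m`, and `t = 0` or `t < r - k`
(so that `M / X` can be truncated to rank `t + 1`).  The function `F` is the `F`-tableau. -/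
noncomputable def Matroid.totalFlatNumber {α : Type*} (M : Matroid α) [M.Finite] (i j : ℤ) : ℤ :=
  ∑ p ∈ (Finset.range (M.natRank + 1) ×ˢ Finset.range (M.E.ncard + 1) ×ˢ
      Finset.range (M.natRank + 1)).filter (fun p : ℕ × ℕ × ℕ =>
        p.1 ≤ p.2.1 ∧ (p.2.2 = 0 ∨ p.1 + p.2.2 < M.natRank) ∧
        (M.natRank : ℤ) - p.1 - p.2.2 = i ∧ (p.2.1 : ℤ) - p.1 - p.2.2 = j),
    M.flatNumber p.1 p.2.1 p.2.2

namespace Matroid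

variable {α : Type*}

/-! After shifting both variables by one, the coefficients of the Tutte polynomial are the numbers
of sets of given rank and size (`rankSizeCount`), so it suffices to compare the `F`-tableau with
these numbers.

For `k + t < r`, each flat `X` of rank `k` contributes to `f^t_{k,m}` the alternating sum over the
supersets of `X` of rank at most `k + t` (`neg_moebius_truncateTo_contract`). The same alternating
sum vanishes when `X` is not a flat. Fixing `i` fixes `c = k + t = r - i`, and then `j` fixes `m = j
+ c`; hence `F_{ij}` is a sum over all `m`-sets `X`. Exchanging sums gives, for `c < r`,
`F_{r-c,m-c} = ∑_s (-1)^(s+m) C(s,m) N_c(s)`, where `N_c(s)` counts `s`-sets of rank at most `c`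
(`totalFlatNumber_sub_sub`).

For fixed `c` this system is unitriangular. Since `N_c(s) = C(n,s)` whenever `c ≥ r` or `s ≤ c`, the
only equations needed to solve it have `c < r` and `m > c`, that is, `i, j ≥ 1`. -/

/-! ### Basic facts on natural-number rank -/

lemma cast_natRk (M : Matroid α) [M.Finite] (A : Set α) : (M.natRk A : ℕ∞) = M.eRk A :=
  ENat.natCast_toNat (eRk_ne_top_iff.2 (M.isRkFinite_set A))

lemma cast_natRank (M : Matroid α) [M.Finite] : (M.natRank : ℕ∞) = M.eRank :=
  ENat.natCast_toNat (M.eRank_ne_top_iff.2 inferInstance)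

lemma natRk_mono (M : Matroid α) [M.Finite] {A B : Set α} (h : A ⊆ B) : M.natRk A ≤ M.natRk B := by
  have := M.eRk_mono h
  rwa [← cast_natRk, ← cast_natRk, Nat.cast_le] at this

lemma natRk_le_natRank (M : Matroid α) [M.Finite] (A : Set α) : M.natRk A ≤ M.natRank := by
  have := M.eRk_le_eRank A
  rwa [← cast_natRk, ← cast_natRank, Nat.cast_le] at this

lemma natRk_le_card (M : Matroid α) [M.Finite] (A : Finset α) : M.natRk (A : Set α) ≤ A.card := by
  have := M.eRk_le_encard A
  rwa [← cast_natRk, encard_coe_eq_coe_finsetCard, Nat.cast_le] at this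

lemma natRk_ground (M : Matroid α) : M.natRk M.E = M.natRank := by
  rw [natRk, eRk_ground, natRank]

lemma natRk_insert_of_mem_closure (M : Matroid α) {A : Set α} {e : α} (he : e ∈ M.closure A) :
    M.natRk (insert e A) = M.natRk A := by
  rw [natRk, natRk, ← eRk_closure_eq, closure_insert_eq_of_mem_closure he, eRk_closure_eq]

lemma mem_groundSubsets {M : Matroid α} [M.Finite] {A : Finset α} :
    A ∈ M.groundSubsets ↔ (A : Set α) ⊆ M.E := by
  rw [groundSubsets, Finset.mem_powerset, ← Finset.coe_subset, Set.Finite.coe_toFinset]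

lemma mem_flatsOf {M : Matroid α} [M.Finite] {k m : ℕ} {X : Finset α} :
    X ∈ M.flatsOf k m ↔ M.IsFlat (X : Set α) ∧ M.natRk (X : Set α) = k ∧ X.card = m := by
  classical
  rw [flatsOf, Finset.mem_filter, mem_groundSubsets]
  exact ⟨fun h ↦ h.2, fun h ↦ ⟨h.1.subset_ground, h⟩⟩

/-! ### Rank in truncations and contractions -/

@[simp] lemma truncateTo_ground (M : Matroid α) (k : ℕ) : (M.truncateTo k).E = M.E := rfl

@[simp] lemma truncateTo_indep_iff (M : Matroid α) (k : ℕ) {I : Set α} :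
    (M.truncateTo k).Indep I ↔ M.Indep I ∧ I.encard ≤ k := by
  simp [truncateTo]

lemma eRk_truncateTo (M : Matroid α) (k : ℕ) (A : Set α) :
    (M.truncateTo k).eRk A = min (M.eRk A) k := by
  refine eq_of_forall_le_iff fun n ↦ ?_
  rw [le_min_iff, le_eRk_iff, le_eRk_iff]
  constructor
  · rintro ⟨I, hIA, hI, rfl⟩
    rw [truncateTo_indep_iff] at hI
    exact ⟨⟨I, hIA, hI.1, rfl⟩, hI.2⟩
  · rintro ⟨⟨I, hIA, hI, rfl⟩, hk⟩
    exact ⟨I, hIA, by simpa using ⟨hI, hk⟩, rfl⟩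

/-- Extend a basis `I` of `X` to a basis `J` of `A ∪ X`. Maximality of `I` gives `J ∩ X = I`, and `J
\ X` is a basis of `A` in the contraction. -/
lemma eRk_contract_add_eRk (M : Matroid α) (X A : Set α) :
    (M.contract X).eRk A + M.eRk X = M.eRk (A ∪ X) := by
  obtain ⟨I, hI⟩ := M.exists_isBasis' X
  obtain ⟨J, hJ, hIJ⟩ := hI.indep.subset_isBasis'_of_subset
    (hI.subset.trans (subset_union_right (s := A)))
  have hXI : J ∩ X = I := by
    refine (hI.eq_of_subset_indep (hJ.indep.inter_right X) (subset_inter hIJ hI.subset)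
      inter_subset_right).symm
  have hb' : (M.contract X).IsBasis' (J \ X) A := by
    rw [isBasis'_iff_isBasis_inter_ground]
    have h := hJ.contract_isBasis' hI (hJ.indep.subset (union_subset sdiff_subset hIJ))
    rw [isBasis'_iff_isBasis_inter_ground] at h
    convert h using 1
    ext e
    simp only [contract_ground, mem_inter_iff, mem_sdiff, mem_union]
    tauto
  rw [hb'.eRk_eq_encard, hI.eRk_eq_encard, hJ.eRk_eq_encard, ← hXI, encard_sdiff_add_encard_inter]

/-! ### The Möbius invariant as a signed count of spanning sets -/

lemma sum_neg_one_pow_card_eq_zero_of_toggle {S : Finset (Finset α)} [DecidableEq α] (e : α)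
    (hi : ∀ B ∈ S, insert e B ∈ S) (he : ∀ B ∈ S, B.erase e ∈ S) :
    ∑ B ∈ S, (-1 : ℤ) ^ B.card = 0 := by
  refine Finset.sum_involution (fun B _ ↦ if e ∈ B then B.erase e else insert e B) ?_ ?_ ?_ ?_
  · intro B _
    split_ifs with h
    · rw [← Finset.card_erase_add_one h]; ring
    · rw [Finset.card_insert_of_notMem h]; ring
  · intro B _ _ heq
    split_ifs at heq with h
    · exact Finset.notMem_erase e B (heq.symm ▸ h)
    · exact h (heq ▸ Finset.mem_insert_self e B)
  · intro B hB
    split_ifs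
    exacts [he B hB, hi B hB]
  · intro B _
    by_cases h : e ∈ B <;> simp [h]

-- Grouping the subsets of a flat `Z` by closure shows that the signed count `g` of sets with
-- closure `Z` satisfies the recursion for the Möbius function. Looplessness makes the bottom flat
-- empty, so that the signed sum over subsets of `Z` is nonzero only at the bottom.
open Classical in
lemma moebius_eq_sum_spanning (M : Matroid α) [M.Finite] [M.Loopless] :
    M.moebius = ∑ A ∈ M.groundSubsets.filter fun A : Finset α ↦ M.Spanning (A : Set α), (-1 : ℤ) ^ A.card := by
  have := Fintype.ofFinite M.FlatLattice
  set bot : M.FlatLattice := ⟨M.closure ∅, M.isFlat_closure ∅⟩ with hbot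
  have hbot_le (Z : M.FlatLattice) : bot ≤ Z := by
    have : M.closure ∅ ⊆ Z.1 := by rw [closure_empty, M.loops_eq_empty]; exact empty_subset _
    exact this
  let g : M.FlatLattice → ℤ := fun Z ↦
    ∑ A ∈ M.groundSubsets.filter fun A : Finset α ↦ M.closure (A : Set α) = Z.1, (-1 : ℤ) ^ A.card
  have hsum (Z : M.FlatLattice) : ∑ Y ∈ Finset.Icc bot Z, g Y = if bot = Z then 1 else 0 := by
    have hfin : Z.1.Finite := M.ground_finite.subset Z.2.subset_ground
    have h1 : ∑ Y ∈ Finset.Icc bot Z, g Y = ∑ A ∈ hfin.toFinset.powerset, (-1 : ℤ) ^ A.card := by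
      rw [← Finset.sum_fiberwise_of_maps_to (t := Finset.Icc bot Z)
        (g := fun A : Finset α ↦ (⟨M.closure A, M.isFlat_closure _⟩ : M.FlatLattice))]
      · refine Finset.sum_congr rfl fun Y hY ↦ Finset.sum_congr ?_ fun _ _ ↦ rfl
        ext A
        have hYZ : Y.1 ⊆ Z.1 := (Finset.mem_Icc.1 hY).2
        simp only [Finset.mem_filter, mem_groundSubsets, Finset.mem_powerset, Subtype.ext_iff,
          ← Finset.coe_subset, Set.Finite.coe_toFinset]
        refine and_congr_left fun h ↦ ⟨fun hA ↦ ?_, fun hA ↦ hA.trans Z.2.subset_ground⟩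
        exact (M.subset_closure _ hA).trans (h.le.trans hYZ)
      · intro A hA
        rw [Finset.mem_powerset, ← Finset.coe_subset, Set.Finite.coe_toFinset] at hA
        refine Finset.mem_Icc.2 ⟨hbot_le _, ?_⟩
        have : M.closure A ⊆ Z.1 := (M.closure_subset_closure hA).trans Z.2.closure.le
        exact this
    rw [h1, Finset.sum_powerset_neg_one_pow_card]
    congr 1
    have h0 : bot.1 = ∅ := by rw [hbot]; exact M.loops_eq_empty
    rw [Set.Finite.toFinset_eq_empty, Subtype.ext_iff, h0, eq_comm (a := ∅)]
  have key (Z : M.FlatLattice) : IncidenceAlgebra.mu ℤ bot Z = g Z := by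
    induction Z using WellFoundedLT.induction with
    | ind Z ih =>
      have h1 := hsum Z
      have h2 := IncidenceAlgebra.sum_Icc_mu_right (𝕜 := ℤ) bot Z
      rw [← Finset.Ico_insert_right (hbot_le Z), Finset.sum_insert Finset.right_notMem_Ico] at h1 h2
      rw [Finset.sum_congr rfl fun Y hY ↦ ih Y (Finset.mem_Ico.1 hY).2] at h2
      linarith
  rw [moebius, if_pos ‹_›, key]
  refine Finset.sum_congr (Finset.filter_congr fun A hA ↦ ?_) fun _ _ ↦ rfl
  rw [spanning_iff_closure_eq (mem_groundSubsets.1 hA)]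

/-! ### Flat numbers as alternating sums over supersets -/

lemma natRk_contract_add_natRk (M : Matroid α) [M.Finite] (X A : Set α) :
    (M.contract X).natRk A + M.natRk X = M.natRk (A ∪ X) := by
  have := M.eRk_contract_add_eRk X A
  simp only [← cast_natRk] at this
  exact_mod_cast this

lemma natRk_truncateTo (M : Matroid α) [M.Finite] (k : ℕ) (A : Set α) :
    (M.truncateTo k).natRk A = min (M.natRk A) k := by
  have := M.eRk_truncateTo k A
  simp only [← cast_natRk] at this
  rwa [← Nat.mono_cast.map_min, Nat.cast_inj] at this

lemma spanning_iff_natRank_le (M : Matroid α) [M.Finite] {A : Set α} (hA : A ⊆ M.E) :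
    M.Spanning A ↔ M.natRank ≤ M.natRk A := by
  rw [spanning_iff_eRk_le hA, ← cast_natRk, ← cast_natRank, Nat.cast_le]

lemma IsFlat.loopless_truncateTo_contract {M : Matroid α} {X : Set α} (hX : M.IsFlat X) (t : ℕ) :
    ((M.contract X).truncateTo (t + 1)).Loopless := by
  refine loopless_iff_forall_isNonloop.2 fun e he ↦ ?_
  rw [← indep_singleton, truncateTo_indep_iff, indep_singleton, contract_isNonloop_iff,
    hX.closure]
  exact ⟨he, by simp⟩

lemma spanning_truncateTo_contract_iff (M : Matroid α) [M.Finite] {X A : Set α} {t : ℕ}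
    (hXE : X ⊆ M.E) (hA : A ⊆ M.E \ X) (ht : M.natRk X + t < M.natRank) :
    ((M.contract X).truncateTo (t + 1)).Spanning A ↔ M.natRk X + t < M.natRk (A ∪ X) := by
  rw [spanning_iff_natRank_le _ hA, ← natRk_ground, natRk_truncateTo, natRk_truncateTo]
  have h1 := M.natRk_contract_add_natRk X A
  have h2 := M.natRk_contract_add_natRk X (M.E \ X)
  rw [sdiff_union_of_subset hXE, natRk_ground] at h2
  simp only [truncateTo_ground, contract_ground]
  omega

lemma sum_neg_one_pow_card_superset_eq_zero (M : Matroid α) [M.Finite] [DecidableEq α]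
    {X : Finset α} (hX : (X : Set α) ⊂ M.E) :
    ∑ B ∈ M.groundSubsets.filter fun B : Finset α ↦ X ⊆ B, (-1 : ℤ) ^ B.card = 0 := by
  obtain ⟨e, heE, heX⟩ := exists_of_ssubset hX
  refine sum_neg_one_pow_card_eq_zero_of_toggle e (fun B hB ↦ ?_) fun B hB ↦ ?_
  all_goals
    rw [Finset.mem_filter, mem_groundSubsets] at hB ⊢
  · rw [Finset.coe_insert]
    exact ⟨insert_subset heE hB.1, hB.2.trans (Finset.subset_insert e B)⟩
  · refine ⟨subset_trans (by simp) hB.1, fun x hx ↦ Finset.mem_erase.2 ⟨?_, hB.2 hx⟩⟩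
    rintro rfl
    exact heX hx

/-- The alternating sum over the supersets of `X` of rank at most `c`. -/
noncomputable def alternatingSum (M : Matroid α) [M.Finite] [DecidableEq α] (c : ℕ)
    (X : Finset α) : ℤ :=
  ∑ B ∈ M.groundSubsets.filter fun B : Finset α ↦ X ⊆ B ∧ M.natRk (B : Set α) ≤ c,
    (-1 : ℤ) ^ (B.card + X.card)

/-- Via `A ↦ A ∪ X`, spanning sets of the truncated contraction become the supersets of `X` of rank
above `rk X + t`. The signed sum over all supersets is zero because `X` is proper, so the
complementary low-rank sum is the negative. -/
lemma neg_moebius_truncateTo_contract (M : Matroid α) [M.Finite] [DecidableEq α] {X : Finset α}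
    (hX : M.IsFlat (X : Set α)) {t : ℕ} (ht : M.natRk (X : Set α) + t < M.natRank) :
    -((M.contract (X : Set α)).truncateTo (t + 1)).moebius =
      M.alternatingSum (M.natRk (X : Set α) + t) X := by
  classical
  have := hX.loopless_truncateTo_contract t
  have hss : (X : Set α) ⊂ M.E := by
    refine hX.subset_ground.ssubset_of_ne fun h ↦ ?_
    rw [h, natRk_ground] at ht
    omega
  have hsum : ((M.contract (X : Set α)).truncateTo (t + 1)).moebius =
      ∑ B ∈ (M.groundSubsets.filter fun B : Finset α ↦ X ⊆ B).filter
        (fun B : Finset α ↦ ¬ M.natRk (B : Set α) ≤ M.natRk (X : Set α) + t),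
        (-1 : ℤ) ^ (B.card + X.card) := by
    rw [moebius_eq_sum_spanning]
    refine Finset.sum_nbij' (· ∪ X) (· \ X) ?_ ?_ ?_ ?_ ?_
    · intro A hA
      rw [Finset.mem_filter, mem_groundSubsets] at hA
      have hA1 : (A : Set α) ⊆ M.E \ X := hA.1
      rw [M.spanning_truncateTo_contract_iff hX.subset_ground hA1 ht] at hA
      simp only [Finset.mem_filter, mem_groundSubsets, Finset.coe_union, not_le]
      exact ⟨⟨union_subset (hA1.trans sdiff_subset) hX.subset_ground,
        Finset.subset_union_right⟩, hA.2⟩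
    · intro B hB
      simp only [Finset.mem_filter, mem_groundSubsets, not_le] at hB
      have hA1 : ((B \ X : Finset α) : Set α) ⊆ M.E \ X := by
        rw [Finset.coe_sdiff]; exact sdiff_subset_sdiff_left hB.1.1
      rw [Finset.mem_filter, mem_groundSubsets,
        M.spanning_truncateTo_contract_iff hX.subset_ground hA1 ht, ← Finset.coe_union,
        Finset.sdiff_union_of_subset hB.1.2]
      exact ⟨hA1, hB.2⟩
    · intro A hA
      rw [Finset.mem_filter, mem_groundSubsets] at hA
      have hA1 : (A : Set α) ⊆ M.E \ X := hA.1
      have hd : Disjoint A X := Finset.disjoint_coe.1 (disjoint_sdiff_left.mono_left hA1)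
      exact Finset.union_sdiff_cancel_right hd
    · intro B hB
      simp only [Finset.mem_filter] at hB
      exact Finset.sdiff_union_of_subset hB.1.2
    · intro A hA
      rw [Finset.mem_filter, mem_groundSubsets] at hA
      have hA1 : (A : Set α) ⊆ M.E \ X := hA.1
      have hd : Disjoint A X := Finset.disjoint_coe.1 (disjoint_sdiff_left.mono_left hA1)
      rw [Finset.card_union_of_disjoint hd, add_assoc, pow_add _ _ (_ + _),
        Even.neg_one_pow ⟨_, rfl⟩, mul_one]
  have h0 : ∑ B ∈ M.groundSubsets.filter fun B : Finset α ↦ X ⊆ B,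
      (-1 : ℤ) ^ (B.card + X.card) = 0 := by
    simp_rw [pow_add]
    rw [← Finset.sum_mul, M.sum_neg_one_pow_card_superset_eq_zero hss, zero_mul]
  rw [← Finset.sum_filter_add_sum_filter_not _
    (fun B : Finset α ↦ M.natRk (B : Set α) ≤ M.natRk (X : Set α) + t), ← hsum] at h0
  rw [alternatingSum, ← Finset.filter_filter]
  linarith

lemma IsFlat.alternatingSum_natRk {M : Matroid α} [M.Finite] [DecidableEq α] {X : Finset α}
    (hX : M.IsFlat (X : Set α)) : M.alternatingSum (M.natRk (X : Set α)) X = 1 := by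
  rw [alternatingSum, Finset.sum_eq_single_of_mem X]
  · exact Even.neg_one_pow ⟨_, rfl⟩
  · simpa [mem_groundSubsets] using hX.subset_ground
  · intro B hB hne
    rw [Finset.mem_filter, mem_groundSubsets] at hB
    refine absurd (Finset.Subset.antisymm ?_ hB.2.1) hne
    have h := (M.isRkFinite_set X).closure_eq_closure_of_subset_of_eRk_ge_eRk
      (Finset.coe_subset.2 hB.2.1) (by rw [← cast_natRk, ← cast_natRk]; exact_mod_cast hB.2.2)
    rw [hX.closure] at h
    rw [← Finset.coe_subset, h]
    exact M.subset_closure _ hB.1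

/-- Toggle an element `e` of the closure of `X` outside `X`: adding it to a superset of `X` keeps
the rank, and deleting it cannot raise the rank. -/
lemma alternatingSum_eq_zero_of_not_isFlat (M : Matroid α) [M.Finite] [DecidableEq α]
    {X : Finset α} (hXE : (X : Set α) ⊆ M.E) (hX : ¬ M.IsFlat (X : Set α)) (c : ℕ) :
    M.alternatingSum c X = 0 := by
  obtain ⟨e, he, heX⟩ : ∃ e ∈ M.closure (X : Set α), e ∉ X := by
    by_contra! h
    exact hX (isFlat_iff_closure_eq.2 (subset_antisymm h (M.subset_closure _ hXE)))
  simp_rw [alternatingSum, pow_add]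
  rw [← Finset.sum_mul, sum_neg_one_pow_card_eq_zero_of_toggle e, zero_mul]
  all_goals
    intro B hB
    rw [Finset.mem_filter, mem_groundSubsets] at hB ⊢
  · rw [Finset.coe_insert, natRk_insert_of_mem_closure _
      (M.closure_subset_closure (Finset.coe_subset.2 hB.2.1) he)]
    exact ⟨insert_subset (mem_ground_of_mem_closure he) hB.1,
      hB.2.1.trans (Finset.subset_insert e B), hB.2.2⟩
  · have hsub : ((B.erase e : Finset α) : Set α) ⊆ B := by simp
    refine ⟨hsub.trans hB.1, fun x hx ↦ Finset.mem_erase.2 ⟨?_, hB.2.1 hx⟩,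
      (M.natRk_mono hsub).trans hB.2.2⟩
    rintro rfl
    exact heX hx

lemma alternatingSum_eq_zero_of_lt (M : Matroid α) [M.Finite] [DecidableEq α] {X : Finset α}
    {c : ℕ} (h : c < M.natRk (X : Set α)) : M.alternatingSum c X = 0 := by
  rw [alternatingSum, Finset.filter_false_of_mem, Finset.sum_empty]
  rintro B - ⟨hXB, hB⟩
  have := M.natRk_mono (Finset.coe_subset.2 hXB)
  omega

lemma flatNumber_eq_sum_alternatingSum (M : Matroid α) [M.Finite] [DecidableEq α] {k t : ℕ}
    (m : ℕ) (h : k + t < M.natRank) :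
    M.flatNumber k m t = ∑ X ∈ M.flatsOf k m, M.alternatingSum (k + t) X := by
  rw [flatNumber]
  split_ifs with ht
  · subst ht
    -- At `t = 0` each flat has alternating sum `1`, so both branches of the definition fit one
    -- formula.
    rw [Finset.sum_congr rfl fun X hX ↦ ?_, Finset.sum_const, nsmul_eq_mul, mul_one]
    obtain ⟨hf, rfl, -⟩ := mem_flatsOf.1 hX
    exact hf.alternatingSum_natRk
  · rw [← Finset.sum_neg_distrib]
    refine Finset.sum_congr rfl fun X hX ↦ ?_
    obtain ⟨hf, rfl, -⟩ := mem_flatsOf.1 hX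
    exact M.neg_moebius_truncateTo_contract hf h

/-- Non-flats and flats of rank above `c` contribute zero, so `X` may run over all `m`-sets. After
exchanging sums, each `B` is counted once per `m`-subset. -/
lemma sum_alternatingSum (M : Matroid α) [M.Finite] [DecidableEq α] (c m : ℕ) :
    ∑ k ∈ Finset.range (min c m + 1), ∑ X ∈ M.flatsOf k m, M.alternatingSum c X =
      ∑ B ∈ M.groundSubsets.filter fun B : Finset α ↦ M.natRk (B : Set α) ≤ c,
        (-1 : ℤ) ^ (B.card + m) * (B.card.choose m : ℤ) := by
  classical
  have h1 : ∑ k ∈ Finset.range (min c m + 1), ∑ X ∈ M.flatsOf k m, M.alternatingSum c X =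
      ∑ X ∈ M.groundSubsets.filter (fun X : Finset α ↦ X.card = m), M.alternatingSum c X := by
    have hS : ∑ X ∈ (M.groundSubsets.filter (fun X : Finset α ↦ X.card = m)).filter
        (fun X : Finset α ↦ M.IsFlat (X : Set α) ∧ M.natRk (X : Set α) ≤ c),
        M.alternatingSum c X =
        ∑ X ∈ M.groundSubsets.filter (fun X : Finset α ↦ X.card = m), M.alternatingSum c X := by
      refine Finset.sum_subset (Finset.filter_subset _ _) fun X hX hX' ↦ ?_
      by_cases hf : M.IsFlat (X : Set α)
      · refine M.alternatingSum_eq_zero_of_lt (not_le.1 fun hc ↦ hX' ?_)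
        exact Finset.mem_filter.2 ⟨hX, hf, hc⟩
      · exact M.alternatingSum_eq_zero_of_not_isFlat
          (mem_groundSubsets.1 (Finset.mem_filter.1 hX).1) hf c
    rw [← hS, ← Finset.sum_fiberwise_of_maps_to (t := Finset.range (min c m + 1))
      (g := fun X : Finset α ↦ M.natRk (X : Set α))]
    · refine Finset.sum_congr rfl fun k hk ↦ Finset.sum_congr ?_ fun _ _ ↦ rfl
      ext X
      rw [Finset.mem_range] at hk
      simp only [mem_flatsOf, Finset.mem_filter, mem_groundSubsets]
      constructor
      · rintro ⟨hf, rfl, rfl⟩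
        exact ⟨⟨⟨hf.subset_ground, rfl⟩, hf, by omega⟩, rfl⟩
      · rintro ⟨⟨⟨-, hm⟩, hf, -⟩, hk⟩
        exact ⟨hf, hk, hm⟩
    · intro X hX
      simp only [Finset.mem_filter] at hX
      have := M.natRk_le_card X
      rw [Finset.mem_range]
      omega
  rw [h1]
  simp_rw [alternatingSum]
  rw [Finset.sum_comm' (t' := M.groundSubsets.filter fun B : Finset α ↦ M.natRk (B : Set α) ≤ c)
    (s' := fun B ↦ B.powersetCard m)]
  · refine Finset.sum_congr rfl fun B _ ↦ ?_
    rw [Finset.sum_congr rfl fun X hX ↦ by rw [(Finset.mem_powersetCard.1 hX).2],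
      Finset.sum_const, Finset.card_powersetCard, nsmul_eq_mul, mul_comm]
  · intro X B
    simp only [Finset.mem_filter, mem_groundSubsets, Finset.mem_powersetCard]
    constructor
    · rintro ⟨⟨-, hm⟩, hB, hXB, hc⟩
      exact ⟨⟨hXB, hm⟩, hB, hc⟩
    · rintro ⟨⟨hXB, hm⟩, hB, hc⟩
      exact ⟨⟨(Finset.coe_subset.2 hXB).trans hB, hm⟩, hB, hXB, hc⟩

/-! ### Counting sets by rank and size, and the Tutte polynomial -/

open Classical in
/-- The number of sets of rank `a` and size `s`. -/
noncomputable def rankSizeCount (M : Matroid α) [M.Finite] (a s : ℕ) : ℕ :=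
  (M.groundSubsets.filter fun A : Finset α ↦ M.natRk (A : Set α) = a ∧ A.card = s).card

lemma card_le_ncard_ground {M : Matroid α} [M.Finite] {A : Finset α} (hA : A ∈ M.groundSubsets) :
    A.card ≤ M.E.ncard := by
  rw [← Set.ncard_coe_finset]
  exact Set.ncard_le_ncard (mem_groundSubsets.1 hA) M.ground_finite

lemma sum_groundSubsets_eq {R : Type*} [Semiring R] (M : Matroid α) [M.Finite] (f : ℕ → ℕ → R) :
    ∑ A ∈ M.groundSubsets, f (M.natRk (A : Set α)) A.card =
      ∑ a ∈ Finset.range (M.natRank + 1), ∑ s ∈ Finset.range (M.E.ncard + 1),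
        (M.rankSizeCount a s : R) * f a s := by
  classical
  rw [← Finset.sum_product', ← Finset.sum_fiberwise_of_maps_to
    (t := Finset.range (M.natRank + 1) ×ˢ Finset.range (M.E.ncard + 1))
    (g := fun A : Finset α ↦ (M.natRk (A : Set α), A.card))]
  · refine Finset.sum_congr rfl fun p _ ↦ ?_
    rw [rankSizeCount, ← nsmul_eq_mul, ← Finset.sum_const]
    refine Finset.sum_congr ?_ fun A hA ↦ ?_
    · simp only [Prod.ext_iff]
    · obtain ⟨-, h1, h2⟩ := Finset.mem_filter.1 hA
      rw [h1, h2]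
  · intro A hA
    have := M.natRk_le_natRank (A : Set α)
    have := card_le_ncard_ground hA
    simp only [Finset.mem_product, Finset.mem_range]
    omega

lemma rankSizeCount_eq_zero (M : Matroid α) [M.Finite] {a s : ℕ}
    (h : M.natRank < a ∨ s < a ∨ M.E.ncard < s) : M.rankSizeCount a s = 0 := by
  classical
  rw [rankSizeCount, Finset.card_eq_zero, Finset.filter_eq_empty_iff]
  rintro A hA ⟨rfl, rfl⟩
  have := M.natRk_le_natRank (A : Set α)
  have := M.natRk_le_card A
  have := card_le_ncard_ground hA
  omega

/-- Either condition makes "rank at most `c`" automatic for an `s`-set. -/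
lemma sum_rankSizeCount_eq_choose (M : Matroid α) [M.Finite] {c s : ℕ}
    (h : M.natRank ≤ c ∨ s ≤ c) :
    ∑ a ∈ Finset.range (c + 1), M.rankSizeCount a s = M.E.ncard.choose s := by
  classical
  rw [Set.ncard_eq_toFinset_card _ M.ground_finite, ← Finset.card_powersetCard,
    Finset.card_eq_sum_card_fiberwise (t := Finset.range (c + 1))
      (f := fun A : Finset α ↦ M.natRk (A : Set α))]
  · refine Finset.sum_congr rfl fun a _ ↦ ?_
    rw [rankSizeCount]
    congr 1
    ext A
    simp only [groundSubsets, Finset.mem_filter, Finset.mem_powerset, Finset.mem_powersetCard]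
    tauto
  · intro A hA
    have h1 := (Finset.mem_powersetCard.1 hA).2
    have := M.natRk_le_natRank (A : Set α)
    have := M.natRk_le_card A
    simp only [Finset.coe_range, mem_Iio]
    omega

lemma coeff_aeval_tuttePoly (M : Matroid α) [M.Finite] {a s : ℕ} (har : a ≤ M.natRank)
    (has : a ≤ s) :
    (MvPolynomial.aeval (fun i ↦ (MvPolynomial.X i + 1 : MvPolynomial (Fin 2) ℤ))
      M.tuttePoly).coeff (Finsupp.single 0 (M.natRank - a) + Finsupp.single 1 (s - a)) =
      M.rankSizeCount a s := by
  classical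
  have hmon (p q : ℕ) : (MvPolynomial.X 0 ^ p * MvPolynomial.X 1 ^ q : MvPolynomial (Fin 2) ℤ) =
      MvPolynomial.monomial (Finsupp.single 0 p + Finsupp.single 1 q) 1 := by
    rw [MvPolynomial.X_pow_eq_monomial, MvPolynomial.X_pow_eq_monomial,
      MvPolynomial.monomial_mul, one_mul]
  simp only [tuttePoly, map_sum, map_mul, map_pow, map_sub, map_one, MvPolynomial.aeval_X,
    add_sub_cancel_right, hmon, MvPolynomial.coeff_sum, MvPolynomial.coeff_monomial]
  rw [Finset.sum_boole, rankSizeCount]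
  congr 2
  refine Finset.filter_congr fun A hA ↦ ?_
  have h1 := M.natRk_le_natRank (A : Set α)
  have h2 := M.natRk_le_card A
  rw [Finsupp.ext_iff, Fin.forall_fin_two]
  simp
  omega

/-! ### Evaluating the `F`-tableau -/

lemma totalFlatNumber_sub_sub (M : Matroid α) [M.Finite] {c : ℕ} (hc : c < M.natRank) (m : ℕ) :
    M.totalFlatNumber (M.natRank - c) (m - c) =
      ∑ s ∈ Finset.range (M.E.ncard + 1),
        ((∑ a ∈ Finset.range (c + 1), M.rankSizeCount a s : ℕ) : ℤ) *
          ((-1) ^ (s + m) * (s.choose m : ℤ)) := by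
  classical
  have h1 : ∑ s ∈ Finset.range (M.E.ncard + 1),
        ((∑ a ∈ Finset.range (c + 1), M.rankSizeCount a s : ℕ) : ℤ) *
          ((-1) ^ (s + m) * (s.choose m : ℤ)) =
      ∑ B ∈ M.groundSubsets.filter fun B : Finset α ↦ M.natRk (B : Set α) ≤ c,
        (-1 : ℤ) ^ (B.card + m) * (B.card.choose m : ℤ) := by
    rw [Finset.sum_filter, M.sum_groundSubsets_eq
      (fun a s ↦ if a ≤ c then (-1 : ℤ) ^ (s + m) * (s.choose m : ℤ) else 0), Finset.sum_comm]
    refine Finset.sum_congr rfl fun s _ ↦ ?_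
    rw [Nat.cast_sum, Finset.sum_mul]
    refine Finset.sum_subset_zero_on_sdiff (Finset.range_mono (by omega)) ?_ ?_
    · intro a ha
      simp only [Finset.mem_sdiff, Finset.mem_range] at ha
      rw [if_neg (by omega), mul_zero]
    · intro a ha
      rw [Finset.mem_range] at ha
      rw [if_pos (by omega)]
  rw [h1, totalFlatNumber]
  rcases le_or_gt m M.E.ncard with hm | hm
  · rw [← sum_alternatingSum]
    -- The two index equations force `k + t = c` and fix `m`, leaving only `k ≤ min c m` free.
    refine Finset.sum_nbij' (fun p ↦ p.1) (fun k ↦ (k, m, c - k)) ?_ ?_ ?_ ?_ ?_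
    · rintro ⟨k, m', t⟩ hp
      simp only [Finset.mem_filter, Finset.mem_product, Finset.mem_range] at hp ⊢
      omega
    · intro k hk
      simp only [Finset.mem_filter, Finset.mem_product, Finset.mem_range] at hk ⊢
      omega
    · rintro ⟨k, m', t⟩ hp
      simp only [Finset.mem_filter, Finset.mem_product, Finset.mem_range] at hp
      refine Prod.ext rfl (Prod.ext ?_ ?_) <;> dsimp only <;> omega
    · intro k _
      rfl
    · rintro ⟨k, m', t⟩ hp
      simp only [Finset.mem_filter, Finset.mem_product, Finset.mem_range] at hp
      obtain rfl : m' = m := by omega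
      obtain rfl : c = k + t := by omega
      exact M.flatNumber_eq_sum_alternatingSum m' hc
  · rw [Finset.filter_false_of_mem, Finset.sum_empty, eq_comm]
    · refine Finset.sum_eq_zero fun B hB ↦ ?_
      have := card_le_ncard_ground (Finset.mem_filter.1 hB).1
      rw [Nat.choose_eq_zero_of_lt (by omega), Nat.cast_zero, mul_zero]
    · rintro ⟨k, m', t⟩ hp
      simp only [Finset.mem_product, Finset.mem_range] at hp ⊢
      omega

lemma card_flatsOf_natRank (M : Matroid α) [M.Finite] (m : ℕ) :
    (M.flatsOf M.natRank m).card = if m = M.E.ncard then 1 else 0 := by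
  classical
  have h (X : Finset α) : X ∈ M.flatsOf M.natRank m ↔
      X = M.ground_finite.toFinset ∧ m = M.E.ncard := by
    rw [mem_flatsOf, Set.ncard_eq_toFinset_card _ M.ground_finite]
    constructor
    · rintro ⟨hf, hr, rfl⟩
      have hsp := (M.spanning_iff_natRank_le hf.subset_ground).2 hr.ge
      have hXE : (X : Set α) = M.E := by rw [← hf.closure, hsp.closure_eq]
      have : X = M.ground_finite.toFinset := by
        rw [← Finset.coe_inj, hXE, Set.Finite.coe_toFinset]
      exact ⟨this, by rw [← this]⟩
    · rintro ⟨rfl, rfl⟩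
      rw [Set.Finite.coe_toFinset]
      exact ⟨M.ground_isFlat, M.natRk_ground, rfl⟩
  split_ifs with hm
  · rw [Finset.card_eq_one]
    exact ⟨M.ground_finite.toFinset, Finset.ext fun X ↦ by rw [h, Finset.mem_singleton, and_iff_left hm]⟩
  · rw [Finset.card_eq_zero]
    exact Finset.eq_empty_of_forall_notMem fun X hX ↦ hm ((h X).1 hX).2

/-- Here `k + t ≥ r`, so admissibility forces `t = 0` and `k = r`; the ground set is the only flat
of that rank. -/
lemma totalFlatNumber_of_nonpos (M : Matroid α) [M.Finite] {i : ℤ} (hi : i ≤ 0) (j : ℤ) :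
    M.totalFlatNumber i j = if i = 0 ∧ j = M.E.ncard - M.natRank then 1 else 0 := by
  classical
  have hrn : M.natRank ≤ M.E.ncard := by
    have := M.natRk_le_card M.ground_finite.toFinset
    rwa [Set.Finite.coe_toFinset, natRk_ground,
      ← Set.ncard_eq_toFinset_card _ M.ground_finite] at this
  rw [totalFlatNumber]
  split_ifs with h
  · rw [Finset.sum_eq_single_of_mem (M.natRank, M.E.ncard, 0)]
    · simp [flatNumber, card_flatsOf_natRank]
    · simp only [Finset.mem_filter, Finset.mem_product, Finset.mem_range]
      refine ⟨by omega, hrn, .inl trivial, ?_, ?_⟩ <;> push_cast <;> omega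
    · rintro ⟨k, m, t⟩ hp hne
      simp only [Finset.mem_filter, Finset.mem_product, Finset.mem_range] at hp
      simp only [ne_eq, Prod.mk.injEq] at hne
      omega
  · refine Finset.sum_eq_zero ?_
    rintro ⟨k, m, t⟩ hp
    simp only [Finset.mem_filter, Finset.mem_product, Finset.mem_range] at hp
    dsimp only
    obtain rfl : t = 0 := by omega
    obtain rfl : k = M.natRank := by omega
    rw [flatNumber, if_pos rfl, card_flatsOf_natRank, if_neg (by omega), Nat.cast_zero]

lemma totalFlatNumber_eq_zero (M : Matroid α) [M.Finite] {i j : ℤ}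
    (h : M.natRank < i ∨ j - i + M.natRank < 0) : M.totalFlatNumber i j = 0 := by
  rw [totalFlatNumber, Finset.filter_false_of_mem, Finset.sum_empty]
  rintro ⟨k, m, t⟩ -
  dsimp only
  omega

/-! ### Comparing two matroids -/

section Comparison

variable {β : Type*} {M : Matroid α} {N : Matroid β} [M.Finite] [N.Finite]

lemma tuttePoly_eq_iff_rankSizeCount_eq (hn : M.E.ncard = N.E.ncard) (hr : M.natRank = N.natRank) :
    M.tuttePoly = N.tuttePoly ↔ ∀ a s, M.rankSizeCount a s = N.rankSizeCount a s := by
  constructor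
  · intro h a s
    by_cases has : M.natRank < a ∨ s < a
    · rw [M.rankSizeCount_eq_zero (by tauto), N.rankSizeCount_eq_zero (by rw [← hr]; tauto)]
    · push Not at has
      have h1 := M.coeff_aeval_tuttePoly has.1 has.2
      rw [h, hr, N.coeff_aeval_tuttePoly (hr ▸ has.1) has.2] at h1
      exact_mod_cast h1.symm
  · intro h
    rw [tuttePoly, tuttePoly,
      M.sum_groundSubsets_eq (fun a s ↦ (MvPolynomial.X 0 - 1) ^ (M.natRank - a) *
        (MvPolynomial.X 1 - 1 : MvPolynomial (Fin 2) ℤ) ^ (s - a)),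
      N.sum_groundSubsets_eq (fun a s ↦ (MvPolynomial.X 0 - 1) ^ (N.natRank - a) *
        (MvPolynomial.X 1 - 1 : MvPolynomial (Fin 2) ℤ) ^ (s - a))]
    simp only [h, hn, hr]

lemma totalFlatNumber_eq_of_rankSizeCount_eq (hn : M.E.ncard = N.E.ncard)
    (hr : M.natRank = N.natRank) (h : ∀ a s, M.rankSizeCount a s = N.rankSizeCount a s) (i j : ℤ) :
    M.totalFlatNumber i j = N.totalFlatNumber i j := by
  rcases le_or_gt i 0 with hi | hi
  · rw [totalFlatNumber_of_nonpos _ hi, totalFlatNumber_of_nonpos _ hi, hn, hr]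
  by_cases hij : (M.natRank : ℤ) < i ∨ j - i + M.natRank < 0
  · rw [M.totalFlatNumber_eq_zero hij, N.totalFlatNumber_eq_zero (hr ▸ hij)]
  push Not at hij
  obtain ⟨c, hc⟩ := Int.eq_ofNat_of_zero_le (sub_nonneg.2 hij.1)
  obtain ⟨m, hm⟩ := Int.eq_ofNat_of_zero_le hij.2
  have hM := M.totalFlatNumber_sub_sub (c := c) (by omega) m
  have hN := N.totalFlatNumber_sub_sub (c := c) (by omega) m
  rw [← hr, ← hn] at hN
  rw [show i = M.natRank - c by omega, show j = m - c by omega, hM, hN]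
  simp only [h]

/-- For each fixed `c`, the unitriangular system is solved by descending induction on the size. -/
lemma rankSizeCount_eq_of_totalFlatNumber_eq (hn : M.E.ncard = N.E.ncard)
    (hr : M.natRank = N.natRank)
    (h : ∀ i j : ℤ, 1 ≤ i → 1 ≤ j → M.totalFlatNumber i j = N.totalFlatNumber i j) (a s : ℕ) :
    M.rankSizeCount a s = N.rankSizeCount a s := by
  have hsum (c s : ℕ) : ∑ a ∈ Finset.range (c + 1), M.rankSizeCount a s =
      ∑ a ∈ Finset.range (c + 1), N.rankSizeCount a s := by
    by_cases hcs : M.natRank ≤ c ∨ s ≤ c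
    · rw [M.sum_rankSizeCount_eq_choose hcs, N.sum_rankSizeCount_eq_choose (hr ▸ hcs), hn]
    push Not at hcs
    obtain ⟨hc, hs⟩ := hcs
    revert hs
    induction s using Nat.strong_decreasing_induction with
    | base =>
      refine ⟨M.E.ncard, fun s hs _ ↦ ?_⟩
      rw [Finset.sum_eq_zero fun a _ ↦ M.rankSizeCount_eq_zero (.inr (.inr hs)),
        Finset.sum_eq_zero fun a _ ↦ N.rankSizeCount_eq_zero (.inr (.inr (hn ▸ hs)))]
    | step m ih =>
      intro hcm
      by_cases hmn : M.E.ncard < m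
      · rw [Finset.sum_eq_zero fun a _ ↦ M.rankSizeCount_eq_zero (.inr (.inr hmn)),
          Finset.sum_eq_zero fun a _ ↦ N.rankSizeCount_eq_zero (.inr (.inr (hn ▸ hmn)))]
      have hF := h (M.natRank - c) (m - c) (by omega) (by omega)
      have hN := N.totalFlatNumber_sub_sub (c := c) (hr ▸ hc) m
      rw [← hr, ← hn] at hN
      have hm : m ∈ Finset.range (M.E.ncard + 1) := Finset.mem_range.2 (by omega)
      have hrest : ∑ s ∈ (Finset.range (M.E.ncard + 1)).erase m,
            ((∑ a ∈ Finset.range (c + 1), M.rankSizeCount a s : ℕ) : ℤ) *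
              ((-1) ^ (s + m) * (s.choose m : ℤ)) =
          ∑ s ∈ (Finset.range (M.E.ncard + 1)).erase m,
            ((∑ a ∈ Finset.range (c + 1), N.rankSizeCount a s : ℕ) : ℤ) *
              ((-1) ^ (s + m) * (s.choose m : ℤ)) := by
        refine Finset.sum_congr rfl fun s hs ↦ ?_
        -- Sizes below `m` have coefficient `C(s,m) = 0`; larger sizes are covered by induction.
        rcases lt_or_gt_of_ne (Finset.ne_of_mem_erase hs) with hlt | hgt
        · rw [Nat.choose_eq_zero_of_lt hlt, Nat.cast_zero, mul_zero, mul_zero, mul_zero]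
        · rw [ih s hgt (hcm.trans hgt)]
      rw [M.totalFlatNumber_sub_sub hc, hN, ← Finset.add_sum_erase _ _ hm,
        ← Finset.add_sum_erase _ _ hm, hrest, add_left_inj, Nat.choose_self,
        Even.neg_one_pow ⟨m, rfl⟩] at hF
      simpa only [Nat.cast_one, mul_one, Nat.cast_inj] using hF
  -- Differences in `c` of the cumulative counts recover the individual ones.
  cases a with
  | zero => simpa using hsum 0 s
  | succ a =>
    have h1 := hsum (a + 1) s
    rw [Finset.sum_range_succ, hsum a s, Finset.sum_range_succ _ (a + 1)] at h1
    exact Nat.add_left_cancel h1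

end Comparison

end Matroid

/-- For two matroids of rank `r` on `n` elements, equality of the Tutte polynomials is equivalent
to equality of the `F`-tableaux; moreover the entries with `i, j ≥ 1` already determine the Tutte
polynomial. -/
theorem corollary9p5 {α : Type*} {β : Type*} (n r : ℕ)
    (M : Matroid α) [M.Finite] (N : Matroid β) [N.Finite]
    (hMn : M.E.ncard = n) (hMr : M.eRank = r) (hNn : N.E.ncard = n) (hNr : N.eRank = r) :
    (M.tuttePoly = N.tuttePoly ↔
      ∀ i j : ℤ, M.totalFlatNumber i j = N.totalFlatNumber i j) ∧
    ((∀ i j : ℤ, 1 ≤ i → 1 ≤ j → M.totalFlatNumber i j = N.totalFlatNumber i j) →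
      M.tuttePoly = N.tuttePoly) := by
  have hn : M.E.ncard = N.E.ncard := hMn.trans hNn.symm
  have hr : M.natRank = N.natRank := by rw [Matroid.natRank, Matroid.natRank, hMr, hNr]
  rw [Matroid.tuttePoly_eq_iff_rankSizeCount_eq hn hr]
  exact ⟨⟨Matroid.totalFlatNumber_eq_of_rankSizeCount_eq hn hr,
    fun h ↦ Matroid.rankSizeCount_eq_of_totalFlatNumber_eq hn hr fun i j _ _ ↦ h i j⟩,
    Matroid.rankSizeCount_eq_of_totalFlatNumber_eq hn hr⟩
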